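/- For $n\ge 2$ let $S_n$ be the set of monic complex polynomials of degree $n$ all of whose zeros lie in the closed unit disk. For a polynomial $q$ let $Z(q)$ be its zero set, and for $p\in S_n$ and $\alpha\in\mathbf C$ put $|p|_\alpha=\min_{w\in Z(p')}|\alpha-w|$ and $d(p)=\max_{z\in Z(p)}|p|_z$. For $p=\prod_{i=1}^n(z-z_i)$ and $q=\prod_{i=1}^n(z-\zeta_i)$ put $\Delta(p,q)=\min_{\sigma}\max_{1\le i\le n}|z_i-\zeta_{\sigma(i)}|$, where $\sigma$ runs over all permutations of $\{1,\dots,n\}$. A polynomial $p\in S_n$ is called linearly inextensible if there are $\varepsilon>0$, $C\ge 0$ and $\kappa>0$, depending only on $p$, such that $d(q)\le d(p)+C\,\Delta(q,p)^{1+\kappa}$ for all $q\in S_n$ with $\Delta(q,p)<\varepsilon$. A complex $m\times n$ matrix $(m_{ij})$ is called positively singular if there are real numbers $\mu_1,\dots,\mu_m\ge 0$, not all $0$, such that $\sum_{i=1}^m\mu_i m_{ij}=0$ for $1\le j\le n$. Let $n\ge 3$ and let $p\in S_n$, $p(z)=\prod_{i=1}^n(z-z_i)$, $p'(z)=n\prod_{j=1}^{n-1}(z-w_j)$,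 where the $z_i$ are pairwise distinct and the $w_j$ are pairwise distinct. Put $a=z_1$ and assume that $|p|_a=d(p)$ and that $|p|_{z_i}<d(p)$ for $2\le i\le n$. For a critical point $w_j$ put $$\alpha_1(w_j;a)=-\frac1{w_j-a}\left[1+\frac{p(w_j)}{(w_j-a)^2p''(w_j)}\right],\qquad \alpha_i(w_j;a)=-\frac{p(w_j)}{(w_j-a)(w_j-z_i)^2p''(w_j)}\quad(2\le i\le n).$$ Let $A(p;a)$ be the matrix with $n$ columns that has the following rows: for each $j$ with $|w_j-a|=|p|_a$, the row $(\alpha_1(w_j;a),\dots,\alpha_n(w_j;a))$; and for each $s$ with $|z_s|=1$, the row whose $s$-th entry is $-\overline{z}_s$ and whose other entries are $0$. Then $p$ is linearly inextensible if and only if $A(p;a)$ is positively singular. -/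

import Mathlib

open Polynomial

namespace Sendov

noncomputable section

/-- The class `S_n` of monic complex polynomials of degree `n` all of whose zeros lie in the
closed unit disk. -/
def S (n : ℕ) : Set ℂ[X] :=
  {p | p.Monic ∧ p.natDegree = n ∧ ∀ z : ℂ, p.IsRoot z → ‖z‖ ≤ 1}

/-- `|p|_α`, the distance from `α` to the (finite) zero set of `p'`. -/
def critRadius (p : ℂ[X]) (α : ℂ) : ℝ :=
  ⨅ w : {w : ℂ // p.derivative.IsRoot w}, ‖α - w‖

/-- `d(p)`, the largest value of `|p|_z` over the (finite) zero set of `p`. -/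
def d (p : ℂ[X]) : ℝ :=
  ⨆ z : {z : ℂ // p.IsRoot z}, critRadius p z

/-- The distance `Δ` between monic polynomials of degree `n`: the least value of
`max_i |z_i - ζ_i|` over all enumerations `z` of the zeros of `p` and `ζ` of the zeros of `q`
(with multiplicity). The norm on `Fin n → ℂ` is the maximum norm. -/
def Δ (n : ℕ) (p q : ℂ[X]) : ℝ :=
  sInf {r : ℝ | ∃ z ζ : Fin n → ℂ,
    p = ∏ i, (X - C (z i)) ∧ q = ∏ i, (X - C (ζ i)) ∧ r = ‖z - ζ‖}

theorem exists_perm_of_prod_eq {n : ℕ} {z z' : Fin n → ℂ}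
    (h : ∏ i, (X - C (z i)) = ∏ i, (X - C (z' i))) :
    ∃ σ : Equiv.Perm (Fin n), z' = z ∘ σ := by
  have h2 := congrArg roots h
  have key : ∀ y : Fin n → ℂ, (∏ i, (X - C (y i))).roots = Finset.univ.val.map y := by
    intro y
    have := roots_multiset_prod_X_sub_C (Finset.univ.val.map y)
    rw [Multiset.map_map] at this
    exact this
  rw [key, key] at h2
  have hcard : ∀ c : ℂ, Fintype.card {i // z' i = c} = Fintype.card {i // z i = c} := by
    intro c
    have h3 := congrArg (Multiset.count c) h2
    rw [Multiset.count_map, Multiset.count_map] at h3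
    rw [Fintype.card_subtype, Fintype.card_subtype]
    simp only [Finset.card, Finset.filter_val, eq_comm (b := c)]
    exact h3.symm
  refine ⟨Equiv.ofFiberEquiv fun c => Fintype.equivOfCardEq (hcard c), ?_⟩
  ext i : 1
  exact (Equiv.ofFiberEquiv_map _ i).symm

/-- For given enumerations of the zeros, `Δ` is the minimum over all permutations. -/
theorem Δ_prod {n : ℕ} (z ζ : Fin n → ℂ) :
    IsLeast (Set.range fun σ : Equiv.Perm (Fin n) => ‖fun i => z i - ζ (σ i)‖)
      (Δ n (∏ i, (X - C (z i))) (∏ i, (X - C (ζ i)))) := by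
  have hset : {r : ℝ | ∃ y η : Fin n → ℂ, ∏ i, (X - C (z i)) = ∏ i, (X - C (y i)) ∧
      ∏ i, (X - C (ζ i)) = ∏ i, (X - C (η i)) ∧ r = ‖y - η‖} =
      Set.range fun σ : Equiv.Perm (Fin n) => ‖fun i => z i - ζ (σ i)‖ := by
    ext r
    constructor
    · rintro ⟨y, η, hy, hη, rfl⟩
      obtain ⟨σ, rfl⟩ := exists_perm_of_prod_eq hy
      obtain ⟨τ, rfl⟩ := exists_perm_of_prod_eq hη
      refine ⟨σ.symm.trans τ, ?_⟩
      have hre : ∀ f : Fin n → ℂ, ‖f ∘ σ‖ = ‖f‖ := by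
        intro f
        apply le_antisymm
        · exact (pi_norm_le_iff_of_nonneg (norm_nonneg _)).2 fun i => norm_le_pi_norm f (σ i)
        · refine (pi_norm_le_iff_of_nonneg (norm_nonneg _)).2 fun i => ?_
          have := norm_le_pi_norm (f ∘ σ) (σ.symm i)
          simpa using this
      show ‖_‖ = _
      rw [← hre]
      congr 1
      ext i
      simp
    · rintro ⟨σ, rfl⟩
      exact ⟨z, ζ ∘ σ, rfl, (Equiv.prod_comp σ fun i => X - C (ζ i)).symm, rfl⟩
  unfold Δ
  rw [hset]
  exact (Set.finite_range _).isCompact.isLeast_sInf (Set.range_nonempty _)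

/-- `p ∈ S_n` is linearly inextensible if `d(q) ≤ d(p) + C Δ(q,p)^{1+κ}` for all `q ∈ S_n` close
to `p`, with some constants `C ≥ 0` and `κ > 0`. -/
def LinearlyInextensible (n : ℕ) (p : ℂ[X]) : Prop :=
  p ∈ S n ∧ ∃ ε : ℝ, 0 < ε ∧ ∃ K : ℝ, 0 ≤ K ∧ ∃ κ : ℝ, 0 < κ ∧
    ∀ q ∈ S n, Δ n q p < ε → d q ≤ d p + K * Δ n q p ^ (1 + κ)

/-- A complex matrix is positively singular if a nontrivial combination of its rows with
nonnegative real coefficients vanishes. -/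
def PositivelySingular {m ι : Type*} [Fintype m] (M : Matrix m ι ℂ) : Prop :=
  ∃ μ : m → ℝ, (∀ i, 0 ≤ μ i) ∧ (∃ i, μ i ≠ 0) ∧ ∀ j, ∑ i, (μ i : ℂ) * M i j = 0

/-- The coefficient `α_i(w; a)`, where `a = z k`. -/
def coeffα {n : ℕ} (p : ℂ[X]) (z : Fin n → ℂ) (k : Fin n) (w : ℂ) (i : Fin n) : ℂ :=
  if i = k then
    -(1 / (w - z k)) *
      (1 + p.eval w / ((w - z k) ^ 2 * p.derivative.derivative.eval w))
  else
    -(p.eval w / ((w - z k) * (w - z i) ^ 2 * p.derivative.derivative.eval w))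

/-- The first-order matrix `A(p; a)` with `a = z k`, where `z` lists the zeros of `p` and `w` the
zeros of `p'`. The first block has one row for each critical point on the circle
`|w - a| = |p|_a`, the second one row for each zero of `p` on the unit circle. -/
def A {n : ℕ} (p : ℂ[X]) (z : Fin n → ℂ) (w : Fin (n - 1) → ℂ) (k : Fin n) :
    Matrix ({j : Fin (n - 1) // ‖w j - z k‖ = critRadius p (z k)} ⊕ {s : Fin n // ‖z s‖ = 1})
      (Fin n) ℂ :=
  Matrix.of fun row i =>
    match row with
    | Sum.inl j => coeffα p z k (w j.1) i
    | Sum.inr s => if i = s.1 then -(starRingEnd ℂ) (z s.1) else 0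

end

end Sendov

/-!
Let the zeros of `p = ∏ (X - z i)` be displaced by `v`. Differentiating `∑ 1 / (w - z i) = 0` shows
that a simple critical point `w` moves, to first order, by a complex-linear function of `v`, called
`critShift z w v` below; with `a = z k`, the first block of `A(p; a)` consists of the differentials
of `log (w j - a)` (`sum_coeffα_mul`), while the second block measures the inward motion of the
zeros on the unit circle. The theorem is therefore a first-order optimality condition for `d` on
`S n`.

The first-order description is made quantitative without an implicit function theorem. The point
`x = w + critShift z w v` satisfies `q'(x) = O(‖v‖ ^ 2) q(x)` for the displaced polynomial `q`,
by an exact identity for `∑ 1 / (x - ζ i)` (`sum_one_div_add_eq`), whereas `q''(x) / q(x)` stays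
away from zero. Since `f' / f = ∑ 1 / (x - u)` for every polynomial `f`, a zero of `f = q'` lies
within `deg f * |f x / f' x|` of `x` (`exists_isRoot_norm_sub_mul_le`). The critical points so found
are distinct, hence they are all of them (`eventually_critical_points`).

If the matrix is positively singular, the relation between its rows must involve the first block,
because the rows of the second have disjoint supports. Pairing it with an admissible displacement
gives a critical point on the extremal circle whose distance to `z k` does not increase to first
order, so `d` increases by at most `O(‖v‖ ^ 2)`. If the matrix is not positively singular, Gordan's
alternative (`exists_re_pos_of_not_positivelySingular`, from Hahn-Banach separation) supplies a
direction with positive pairing with all rows; moving along it stays in `S n` and increases `d` at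
a linear rate, which no bound `C Δ ^ (1 + κ)` allows.
-/

namespace Sendov

open Filter Topology

/-! ### A theorem of the alternative -/

/-- Gordan's alternative, over `ℂ`: if no nontrivial nonnegative combination of the rows vanishes,
some vector has positive real pairing with every row. -/
theorem exists_re_pos_of_not_positivelySingular {m ι : Type*} [Fintype m] [Fintype ι]
    {M : Matrix m ι ℂ} (h : ¬ PositivelySingular M) :
    ∃ v : ι → ℂ, ∀ r, 0 < (∑ i, M r i * v i).re := by
  classical
  let T : (m → ℝ) →ₗ[ℝ] (ι → ℂ) := Fintype.linearCombination ℝ (fun r => M r)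
  have hT : ∀ μ i, T μ i = ∑ r, (μ r : ℂ) * M r i := by
    intro μ i
    simp [T, Fintype.linearCombination_apply]
  have hTc : Continuous T := T.continuous_of_finiteDimensional
  have hconv : Convex ℝ (T '' stdSimplex ℝ m) := (convex_stdSimplex ℝ m).linear_image T
  have hcl : IsClosed (T '' stdSimplex ℝ m) := ((isCompact_stdSimplex ℝ m).image hTc).isClosed
  have h0 : (0 : ι → ℂ) ∉ T '' stdSimplex ℝ m := by
    rintro ⟨μ, hμ, hμ0⟩
    refine h ⟨μ, hμ.1, ?_, fun j => by rw [← hT, hμ0]; rfl⟩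
    by_contra! hall
    have := hμ.2
    simp [hall] at this
  obtain ⟨f, u, hu0, hu⟩ := RCLike.geometric_hahn_banach_point_closed (𝕜 := ℂ) hconv hcl h0
  refine ⟨fun i => f (Pi.single i 1), fun r => ?_⟩
  have h1 : M r ∈ T '' stdSimplex ℝ m := by
    refine ⟨Pi.single r 1, single_mem_stdSimplex ℝ r, ?_⟩
    simp [T]
  have h2 := hu _ h1
  have h3 : f (M r) = ∑ i, M r i * f (Pi.single i 1) := by
    conv_lhs => rw [pi_eq_sum_univ' (M r)]
    rw [map_sum]
    simp
  rw [← h3]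
  simp at hu0
  exact hu0.trans h2

/-! ### Zeros near an approximate zero -/

/-- A Newton-type estimate: since `f' / f = ∑ 1 / (x - u)` over the zeros `u` of `f`, one of the
zeros lies within `deg f * |f x / f' x|` of `x`. -/
theorem exists_isRoot_norm_sub_mul_le {f : ℂ[X]} {x : ℂ} (hx : f.derivative.eval x ≠ 0) :
    ∃ u, f.IsRoot u ∧ ‖x - u‖ * ‖f.derivative.eval x‖ ≤ f.natDegree * ‖f.eval x‖ := by
  by_cases h0 : f.eval x = 0
  · exact ⟨x, h0, by simp [h0]⟩
  have hf0 : f ≠ 0 := by rintro rfl; simp at h0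
  have hsum := (IsAlgClosed.splits f).eval_derivative_div_eval_of_ne_zero h0
  by_contra! hcon
  have hne : f.roots ≠ 0 := by
    intro h
    rw [h] at hsum
    simp [h0, hx] at hsum
  have hpos : 0 < ‖f.derivative.eval x‖ := norm_pos_iff.2 hx
  have hpos' : 0 < ‖f.eval x‖ := norm_pos_iff.2 h0
  have hdeg : 0 < f.natDegree := by
    rw [(IsAlgClosed.splits f).natDegree_eq_card_roots]
    exact Multiset.card_pos.2 hne
  obtain ⟨u0, hu0⟩ := Multiset.exists_mem_of_ne_zero hne
  obtain ⟨u, hu, hmin⟩ := f.roots.toFinset.exists_min_image (fun u => ‖x - u‖)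
    ⟨u0, Multiset.mem_toFinset.2 hu0⟩
  have hur : f.IsRoot u := (mem_roots hf0).1 (Multiset.mem_toFinset.1 hu)
  have hxu : 0 < ‖x - u‖ := by
    rw [norm_pos_iff, sub_ne_zero]
    rintro rfl
    exact h0 hur
  have hbound : ‖f.derivative.eval x / f.eval x‖ ≤ f.natDegree * (1 / ‖x - u‖) := by
    rw [hsum, (IsAlgClosed.splits f).natDegree_eq_card_roots]
    refine (norm_multiset_sum_le _).trans ?_
    rw [Multiset.map_map]
    refine (Multiset.sum_le_card_nsmul _ (1 / ‖x - u‖) ?_).trans ?_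
    · intro y hy
      obtain ⟨u', hu', rfl⟩ := Multiset.mem_map.1 hy
      have := hmin u' (Multiset.mem_toFinset.2 hu')
      simp only [Function.comp, norm_div, norm_one]
      gcongr
    · simp
  have := hcon u hur
  rw [norm_div, mul_one_div, div_le_div_iff₀ hpos' hxu] at hbound
  linarith

/-! ### Logarithmic derivatives of a product of linear factors -/

theorem eval_derivative_prod_X_sub_C {ι : Type*} [Fintype ι] (ζ : ι → ℂ) {x : ℂ}
    (hx : ∀ i, x - ζ i ≠ 0) :
    (derivative (∏ i, (X - C (ζ i)))).eval x =
      (∏ i, (X - C (ζ i))).eval x * ∑ i, 1 / (x - ζ i) := by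
  classical
  rw [derivative_prod_finset, eval_finsetSum, Finset.mul_sum]
  refine Finset.sum_congr rfl fun i hi => ?_
  rw [← Finset.mul_prod_erase _ _ hi]
  simp only [derivative_sub, derivative_X, derivative_C, sub_zero, eval_mul, eval_sub, eval_X,
    eval_C, eval_one]
  field_simp [hx i]

theorem eval_derivative_derivative_prod_X_sub_C {ι : Type*} [Fintype ι] (ζ : ι → ℂ) {x : ℂ}
    (hx : ∀ i, x - ζ i ≠ 0) :
    (derivative (derivative (∏ i, (X - C (ζ i))))).eval x =
      (∏ i, (X - C (ζ i))).eval x *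
        ((∑ i, 1 / (x - ζ i)) ^ 2 - ∑ i, 1 / (x - ζ i) ^ 2) := by
  set q := ∏ i, (X - C (ζ i)) with hq
  have h1 : HasDerivAt (fun y => q.derivative.eval y) (q.derivative.derivative.eval x) x :=
    q.derivative.hasDerivAt x
  have h2 : HasDerivAt (fun y => q.eval y * ∑ i, 1 / (y - ζ i))
      (q.derivative.eval x * (∑ i, 1 / (x - ζ i)) +
        q.eval x * ∑ i, -1 / (x - ζ i) ^ 2) x := by
    refine (q.hasDerivAt x).mul (HasDerivAt.fun_sum fun i _ => ?_)
    simpa [one_div] using ((hasDerivAt_id x).sub_const (ζ i)).fun_inv (hx i)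
  have hev : (fun y => q.derivative.eval y) =ᶠ[𝓝 x] fun y => q.eval y * ∑ i, 1 / (y - ζ i) := by
    have : ∀ᶠ y in 𝓝 x, ∀ i, y - ζ i ≠ 0 := by
      rw [eventually_all]
      intro i
      exact ((continuous_id.sub continuous_const).continuousAt).eventually_ne (hx i)
    filter_upwards [this] with y hy using eval_derivative_prod_X_sub_C ζ hy
  rw [h1.unique (h2.congr_of_eventuallyEq hev), eval_derivative_prod_X_sub_C ζ hx]
  simp only [neg_div, Finset.sum_neg_distrib]
  ring

/-! ### First-order motion of the critical points -/

/-- The first-order displacement of the critical point `w` of `∏ (X - z i)` when the zeros are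
displaced by `v`, obtained by differentiating `∑ 1 / (w - z i) = 0`. -/
noncomputable def critShift {ι : Type*} [Fintype ι] (z : ι → ℂ) (w : ℂ) (v : ι → ℂ) : ℂ :=
  (∑ i, v i / (w - z i) ^ 2) / ∑ i, 1 / (w - z i) ^ 2

theorem continuous_critShift {ι : Type*} [Fintype ι] (z : ι → ℂ) (w : ℂ) :
    Continuous (critShift z w) := by
  unfold critShift
  fun_prop

theorem critShift_zero {ι : Type*} [Fintype ι] (z : ι → ℂ) (w : ℂ) :
    critShift z w 0 = 0 := by
  simp [critShift]

theorem critShift_smul {ι : Type*} [Fintype ι] (z : ι → ℂ) (w : ℂ) (t : ℝ) (v : ι → ℂ) :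
    critShift z w (t • v) = t * critShift z w v := by
  simp only [critShift, Pi.smul_apply, Complex.real_smul, mul_div_assoc, ← Finset.mul_sum]

theorem exists_norm_critShift_le {ι : Type*} [Fintype ι] (z : ι → ℂ) (w : ℂ) :
    ∃ B, 0 ≤ B ∧ ∀ v, ‖critShift z w v‖ ≤ B * ‖v‖ := by
  refine ⟨(∑ i, 1 / ‖w - z i‖ ^ 2) / ‖∑ i, 1 / (w - z i) ^ 2‖, by positivity, fun v => ?_⟩
  rw [critShift, norm_div, div_mul_eq_mul_div]
  gcongr
  refine (norm_sum_le _ _).trans ?_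
  rw [Finset.sum_mul]
  refine Finset.sum_le_sum fun i _ => ?_
  rw [norm_div, norm_pow, div_mul_eq_mul_div, one_mul]
  gcongr
  exact norm_le_pi_norm v i

/-- When `∑ 1 / b i = 0`, a perturbation `δ` annihilated by the differential of this expression
changes it only to second order. -/
theorem sum_one_div_add_eq {ι : Type*} [Fintype ι] {b δ : ι → ℂ} (hb : ∀ i, b i ≠ 0)
    (hbδ : ∀ i, b i + δ i ≠ 0) (h1 : ∑ i, 1 / b i = 0) (h2 : ∑ i, δ i / b i ^ 2 = 0) :
    ∑ i, 1 / (b i + δ i) = ∑ i, δ i ^ 2 * (1 / (b i ^ 2 * (b i + δ i))) := by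
  have : ∀ i, 1 / (b i + δ i) =
      1 / b i - δ i / b i ^ 2 + δ i ^ 2 * (1 / (b i ^ 2 * (b i + δ i))) := by
    intro i
    have := hb i
    have := hbδ i
    field_simp
    ring
  rw [Finset.sum_congr rfl fun i _ => this i, Finset.sum_add_distrib, Finset.sum_sub_distrib, h1,
    h2]
  simp

theorem sum_critShift_sub_div {ι : Type*} [Fintype ι] (z : ι → ℂ) {w : ℂ} (v : ι → ℂ)
    (h2 : ∑ i, 1 / (w - z i) ^ 2 ≠ 0) :
    ∑ i, (critShift z w v - v i) / (w - z i) ^ 2 = 0 := by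
  have : ∀ i, (critShift z w v - v i) / (w - z i) ^ 2 =
      critShift z w v * (1 / (w - z i) ^ 2) - v i / (w - z i) ^ 2 := by
    intro i; ring
  rw [Finset.sum_congr rfl fun i _ => this i, Finset.sum_sub_distrib, ← Finset.mul_sum, critShift,
    div_mul_cancel₀ _ h2, sub_self]

/-- If `w` is a nondegenerate critical point of `∏ (X - z i)`, then `∏ (X - z i - v i)` has a
critical point within `O(‖v‖ ^ 2)` of `w + critShift z w v`. -/
theorem eventually_exists_isRoot_derivative {ι : Type*} [Fintype ι] (z : ι → ℂ) {w : ℂ}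
    (hw : ∀ i, w - z i ≠ 0) (h1 : ∑ i, 1 / (w - z i) = 0) (h2 : ∑ i, 1 / (w - z i) ^ 2 ≠ 0) :
    ∃ K, 0 ≤ K ∧ ∀ᶠ v in 𝓝 (0 : ι → ℂ), ∃ u,
      (derivative (∏ i, (X - C (z i + v i)))).IsRoot u ∧
        ‖u - (w + critShift z w v)‖ ≤ K * ‖v‖ ^ 2 := by
  obtain ⟨B, hB0, hB⟩ := exists_norm_critShift_le z w
  set δ : (ι → ℂ) → ι → ℂ := fun v i => critShift z w v - v i with hδ
  have hδc : ∀ i, Continuous fun v => δ v i := fun i =>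
    (continuous_critShift z w).sub (continuous_apply i)
  have hδ0 : ∀ i, δ 0 i = 0 := by simp [hδ, critShift_zero]
  have hδB : ∀ v i, ‖δ v i‖ ≤ (B + 1) * ‖v‖ := by
    intro v i
    refine (norm_sub_le _ _).trans ?_
    rw [add_mul, one_mul]
    exact add_le_add (hB v) (norm_le_pi_norm v i)
  have hne : ∀ᶠ v in 𝓝 (0 : ι → ℂ), ∀ i, w - z i + δ v i ≠ 0 := by
    rw [eventually_all]
    intro i
    refine (continuous_const.add (hδc i)).continuousAt.eventually_ne ?_
    simpa [hδ0] using hw i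
  -- The coefficient of the quadratic remainder stays bounded,
  set g : (ι → ℂ) → ℝ := fun v => ∑ i, ‖1 / ((w - z i) ^ 2 * (w - z i + δ v i))‖ with hg
  have hgc : ContinuousAt g 0 := by
    refine tendsto_finsetSum _ fun i _ => ?_
    refine (ContinuousAt.div continuousAt_const
      (continuous_const.mul (continuous_const.add (hδc i))).continuousAt ?_).norm
    simp [hδ0, hw i]
  have hgb : ∀ᶠ v in 𝓝 (0 : ι → ℂ), g v < g 0 + 1 := hgc.eventually_lt_const (by linarith)
  -- and the second logarithmic quotient stays away from zero.
  set s : (ι → ℂ) → ℂ := fun v => (∑ i, 1 / (w - z i + δ v i)) ^ 2 -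
    ∑ i, 1 / (w - z i + δ v i) ^ 2 with hs
  have hsc : ContinuousAt s 0 := by
    refine ContinuousAt.sub (ContinuousAt.pow (tendsto_finsetSum _ fun i _ => ?_) 2)
      (tendsto_finsetSum _ fun i _ => ?_)
    · refine (ContinuousAt.div continuousAt_const
        (continuous_const.add (hδc i)).continuousAt ?_)
      simp [hδ0, hw i]
    · refine (ContinuousAt.div continuousAt_const
        ((continuous_const.add (hδc i)).pow 2).continuousAt ?_)
      simp [hδ0, hw i]
  have hs0 : s 0 = -∑ i, 1 / (w - z i) ^ 2 := by
    simp only [hs, hδ0, add_zero, h1]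
    ring
  set c := ‖∑ i, 1 / (w - z i) ^ 2‖ with hc
  have hcpos : 0 < c := norm_pos_iff.2 h2
  have hsb : ∀ᶠ v in 𝓝 (0 : ι → ℂ), c / 2 < ‖s v‖ := by
    refine hsc.norm.eventually_const_lt ?_
    show c / 2 < ‖s 0‖
    rw [hs0, norm_neg]
    linarith
  have hg0 : 0 ≤ g 0 := by positivity
  refine ⟨Fintype.card ι * ((g 0 + 1) * (B + 1) ^ 2) / (c / 2), by positivity, ?_⟩
  filter_upwards [hne, hgb, hsb] with v hv hgv hsv
  set x := w + critShift z w v with hx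
  have hxz : ∀ i, x - (z i + v i) = w - z i + δ v i := by
    intro i
    simp only [hx, hδ]
    ring
  have hxne : ∀ i, x - (z i + v i) ≠ 0 := fun i => by rw [hxz]; exact hv i
  set q := ∏ i, (X - C (z i + v i)) with hq
  have hq1 := eval_derivative_prod_X_sub_C (fun i => z i + v i) hxne
  have hq2 := eval_derivative_derivative_prod_X_sub_C (fun i => z i + v i) hxne
  rw [← hq] at hq1 hq2
  simp only [hxz] at hq1 hq2
  have hqx : q.eval x ≠ 0 := by
    rw [hq, eval_prod, Finset.prod_ne_zero_iff]
    intro i _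
    simpa using hxne i
  have hsv0 : s v ≠ 0 := norm_pos_iff.1 (lt_trans (by positivity) hsv)
  have hsum : ‖∑ i, 1 / (w - z i + δ v i)‖ ≤ (g 0 + 1) * (B + 1) ^ 2 * ‖v‖ ^ 2 := by
    rw [sum_one_div_add_eq hw hv h1 (sum_critShift_sub_div z v h2)]
    refine (norm_sum_le _ _).trans ?_
    calc ∑ i, ‖δ v i ^ 2 * (1 / ((w - z i) ^ 2 * (w - z i + δ v i)))‖
        ≤ ∑ i, ((B + 1) * ‖v‖) ^ 2 * ‖1 / ((w - z i) ^ 2 * (w - z i + δ v i))‖ := by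
          refine Finset.sum_le_sum fun i _ => ?_
          rw [norm_mul, norm_pow]
          gcongr
          exact hδB v i
      _ = ((B + 1) * ‖v‖) ^ 2 * g v := by rw [hg, Finset.mul_sum]
      _ ≤ ((B + 1) * ‖v‖) ^ 2 * (g 0 + 1) := by gcongr
      _ = _ := by ring
  obtain ⟨u, hu, hule⟩ := exists_isRoot_norm_sub_mul_le (f := q.derivative) (x := x) (by
    rw [hq2]; exact mul_ne_zero hqx hsv0)
  refine ⟨u, hu, ?_⟩
  have hdeg : (q.derivative.natDegree : ℝ) ≤ Fintype.card ι := by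
    have h3 := natDegree_derivative_le q
    have h4 : q.natDegree = Fintype.card ι := by
      rw [hq, natDegree_finsetProd_X_sub_C_eq_card]
      rfl
    exact_mod_cast (h3.trans (Nat.sub_le _ _)).trans h4.le
  rw [hq1, hq2, norm_mul, norm_mul] at hule
  have hqpos : 0 < ‖q.eval x‖ := norm_pos_iff.2 hqx
  have h5 : ‖x - u‖ * ‖s v‖ ≤ Fintype.card ι * ‖∑ i, 1 / (w - z i + δ v i)‖ := by
    have : ‖x - u‖ * ‖s v‖ ≤ q.derivative.natDegree * ‖∑ i, 1 / (w - z i + δ v i)‖ := by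
      refine le_of_mul_le_mul_right ?_ hqpos
      calc _ = ‖x - u‖ * (‖q.eval x‖ * ‖s v‖) := by ring
        _ ≤ _ := hule
        _ = _ := by ring
    exact this.trans (by gcongr)
  rw [norm_sub_rev, div_mul_eq_mul_div, le_div_iff₀ (by positivity)]
  calc ‖x - u‖ * (c / 2) ≤ ‖x - u‖ * ‖s v‖ := by gcongr
    _ ≤ Fintype.card ι * ‖∑ i, 1 / (w - z i + δ v i)‖ := h5
    _ ≤ Fintype.card ι * ((g 0 + 1) * (B + 1) ^ 2 * ‖v‖ ^ 2) := by gcongr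
    _ = _ := by ring

/-! ### Simple zeros and simple critical points -/

theorem eval_derivative_ne_zero_of_injective {ι : Type*} [Fintype ι] {f : ι → ℂ}
    (hf : Function.Injective f) (i : ι) :
    (derivative (∏ i, (X - C (f i)))).eval (f i) ≠ 0 := by
  have h := (separable_prod_X_sub_C_iff.2 hf).aeval_derivative_ne_zero (x := f i) (by
    rw [coe_aeval_eq_eval, eval_prod]
    exact Finset.prod_eq_zero (Finset.mem_univ i) (by simp))
  simpa [coe_aeval_eq_eval] using h

theorem isRoot_prod_X_sub_C_iff {ι : Type*} [Fintype ι] {f : ι → ℂ} {x : ℂ} :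
    (∏ i, (X - C (f i))).IsRoot x ↔ ∃ i, x = f i := by
  simp [IsRoot.def, eval_prod, Finset.prod_eq_zero_iff, sub_eq_zero]

section CriticalPoints

variable {n : ℕ} {z : Fin n → ℂ} {w : Fin (n - 1) → ℂ}

theorem isRoot_derivative_iff (hn : n ≠ 0)
    (hw : derivative (∏ i, (X - C (z i))) = C (n : ℂ) * ∏ j, (X - C (w j))) {x : ℂ} :
    (derivative (∏ i, (X - C (z i)))).IsRoot x ↔ ∃ j, x = w j := by
  rw [← isRoot_prod_X_sub_C_iff, hw, IsRoot.def, eval_mul, eval_C, mul_eq_zero]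
  simp [hn]

theorem critical_sub_zero_ne_zero (hn : n ≠ 0) (hz : Function.Injective z)
    (hw : derivative (∏ i, (X - C (z i))) = C (n : ℂ) * ∏ j, (X - C (w j)))
    (j : Fin (n - 1)) (i : Fin n) : w j - z i ≠ 0 := by
  intro h
  rw [sub_eq_zero] at h
  apply eval_derivative_ne_zero_of_injective hz i
  rw [← h]
  exact (isRoot_derivative_iff hn hw).2 ⟨j, rfl⟩

theorem eval_prod_critical_ne_zero (hn : n ≠ 0) (hz : Function.Injective z)
    (hw : derivative (∏ i, (X - C (z i))) = C (n : ℂ) * ∏ j, (X - C (w j)))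
    (j : Fin (n - 1)) : (∏ i, (X - C (z i))).eval (w j) ≠ 0 := by
  rw [eval_prod, Finset.prod_ne_zero_iff]
  intro i _
  simpa using critical_sub_zero_ne_zero hn hz hw j i

theorem sum_one_div_critical_sub (hn : n ≠ 0) (hz : Function.Injective z)
    (hw : derivative (∏ i, (X - C (z i))) = C (n : ℂ) * ∏ j, (X - C (w j)))
    (j : Fin (n - 1)) : ∑ i, 1 / (w j - z i) = 0 := by
  have h := eval_derivative_prod_X_sub_C z (critical_sub_zero_ne_zero hn hz hw j)
  rw [((isRoot_derivative_iff hn hw).2 ⟨j, rfl⟩ : IsRoot _ (w j))] at h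
  exact (mul_eq_zero.1 h.symm).resolve_left (eval_prod_critical_ne_zero hn hz hw j)

theorem eval_derivative_derivative_critical (hn : n ≠ 0) (hz : Function.Injective z)
    (hw : derivative (∏ i, (X - C (z i))) = C (n : ℂ) * ∏ j, (X - C (w j)))
    (j : Fin (n - 1)) :
    (derivative (derivative (∏ i, (X - C (z i))))).eval (w j) =
      -((∏ i, (X - C (z i))).eval (w j) * ∑ i, 1 / (w j - z i) ^ 2) := by
  rw [eval_derivative_derivative_prod_X_sub_C z (critical_sub_zero_ne_zero hn hz hw j),
    sum_one_div_critical_sub hn hz hw j]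
  ring

theorem sum_one_div_critical_sub_sq_ne_zero (hn : n ≠ 0) (hz : Function.Injective z)
    (hw : derivative (∏ i, (X - C (z i))) = C (n : ℂ) * ∏ j, (X - C (w j)))
    (hwi : Function.Injective w) (j : Fin (n - 1)) :
    ∑ i, 1 / (w j - z i) ^ 2 ≠ 0 := by
  intro h
  have h1 := eval_derivative_derivative_critical hn hz hw j
  rw [h, hw, derivative_C_mul, eval_mul, eval_C, mul_zero, neg_zero] at h1
  exact (mul_ne_zero (by exact_mod_cast hn) (eval_derivative_ne_zero_of_injective hwi j)) h1

/-- The row of `A(p; a)` belonging to a critical point `w j` is the differential of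
`log (w j - a)` with respect to the zeros of `p`. -/
theorem sum_coeffα_mul (hn : n ≠ 0) (hz : Function.Injective z)
    (hw : derivative (∏ i, (X - C (z i))) = C (n : ℂ) * ∏ j, (X - C (w j)))
    (hwi : Function.Injective w) (k : Fin n) (j : Fin (n - 1)) (v : Fin n → ℂ) :
    ∑ i, coeffα (∏ i, (X - C (z i))) z k (w j) i * v i =
      (critShift z (w j) v - v k) / (w j - z k) := by
  have hne := critical_sub_zero_ne_zero hn hz hw j
  have hp := eval_prod_critical_ne_zero hn hz hw j
  have hs := sum_one_div_critical_sub_sq_ne_zero hn hz hw hwi j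
  have h2 := eval_derivative_derivative_critical hn hz hw j
  have hc : ∀ i, coeffα (∏ i, (X - C (z i))) z k (w j) i * v i =
      (v i / (w j - z i) ^ 2) * (1 / ((∑ i, 1 / (w j - z i) ^ 2) * (w j - z k))) -
        if i = k then v i / (w j - z k) else 0 := by
    intro i
    unfold coeffα
    rw [h2]
    generalize (∏ i, (X - C (z i))).eval (w j) = P at hp
    generalize ∑ i, 1 / (w j - z i) ^ 2 = s at hs
    split_ifs with hik
    · subst hik
      have := hne i
      field_simp
      ring
    · have := hne i
      have := hne k
      field_simp
      ring
  rw [Finset.sum_congr rfl fun i _ => hc i, Finset.sum_sub_distrib, ← Finset.sum_mul,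
    Finset.sum_ite_eq' Finset.univ k, if_pos (Finset.mem_univ k), critShift, sub_div, div_div,
    mul_one_div]

/-- For small displacements `v` of the zeros, the critical points are exactly the points close to
those predicted to first order by `critShift`: distinct critical points stay apart, so the `n - 1`
nearby ones exhaust the zeros of the derivative. -/
theorem eventually_critical_points (hn : n ≠ 0) (hz : Function.Injective z)
    (hw : derivative (∏ i, (X - C (z i))) = C (n : ℂ) * ∏ j, (X - C (w j)))
    (hwi : Function.Injective w) :
    ∃ K, 0 ≤ K ∧ ∀ᶠ v in 𝓝 (0 : Fin n → ℂ), ∃ u : Fin (n - 1) → ℂ,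
      (∀ j, ‖u j - (w j + critShift z (w j) v)‖ ≤ K * ‖v‖ ^ 2) ∧
      ∀ x, (derivative (∏ i, (X - C (z i + v i)))).IsRoot x ↔ ∃ j, x = u j := by
  classical
  choose K hK0 hK using fun j => eventually_exists_isRoot_derivative z
    (critical_sub_zero_ne_zero hn hz hw j) (sum_one_div_critical_sub hn hz hw j)
    (sum_one_div_critical_sub_sq_ne_zero hn hz hw hwi j)
  have hKs : ∀ j, K j ≤ ∑ j, K j := fun j =>
    Finset.single_le_sum (fun j _ => hK0 j) (Finset.mem_univ j)
  refine ⟨∑ j, K j, Finset.sum_nonneg fun j _ => hK0 j, ?_⟩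
  have hsep : ∀ᶠ v in 𝓝 (0 : Fin n → ℂ), ∀ j l, j ≠ l →
      ‖critShift z (w j) v‖ + ‖critShift z (w l) v‖ + 2 * ((∑ j, K j) * ‖v‖ ^ 2) <
        ‖w j - w l‖ := by
    rw [eventually_all]; intro j
    rw [eventually_all]; intro l
    by_cases hjl : j = l
    · simp [hjl]
    have hc : Continuous fun v : Fin n → ℂ => ‖critShift z (w j) v‖ + ‖critShift z (w l) v‖ +
        2 * ((∑ j, K j) * ‖v‖ ^ 2) := by
      have := continuous_critShift z (w j)
      have := continuous_critShift z (w l)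
      fun_prop
    refine (hc.continuousAt.eventually_lt_const ?_).mono fun v hv _ => hv
    simpa [critShift_zero, sub_eq_zero] using fun h => hjl (hwi h)
  filter_upwards [eventually_all.2 hK, hsep] with v hv hsv
  choose u hu hub using hv
  have hub' : ∀ j, ‖u j - (w j + critShift z (w j) v)‖ ≤ (∑ j, K j) * ‖v‖ ^ 2 := fun j =>
    (hub j).trans (by gcongr; exact hKs j)
  refine ⟨u, hub', fun x => ⟨fun hx => ?_, by rintro ⟨j, rfl⟩; exact hu j⟩⟩
  have huinj : Function.Injective u := by
    intro j l hjl
    by_contra hne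
    have h1 := hsv j l hne
    have h2 : w j - w l = (u l - (w l + critShift z (w l) v)) -
        (u j - (w j + critShift z (w j) v)) + critShift z (w l) v - critShift z (w j) v := by
      rw [hjl]; ring
    have h3 : ‖w j - w l‖ ≤ ‖u l - (w l + critShift z (w l) v)‖ +
        ‖u j - (w j + critShift z (w j) v)‖ + ‖critShift z (w l) v‖ +
        ‖critShift z (w j) v‖ := by
      rw [h2]
      refine (norm_sub_le _ _).trans (add_le_add_left ((norm_add_le _ _).trans
        (add_le_add_left (norm_sub_le _ _) _)) _)
    have := hub' j
    have := hub' l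
    linarith
  set q := ∏ i, (X - C (z i + v i)) with hq
  have hqn : q.natDegree = n := by
    rw [hq, natDegree_finsetProd_X_sub_C_eq_card]
    simp
  have hq0 : q.derivative ≠ 0 := by
    intro h
    exact hn (hqn ▸ derivative_eq_zero.1 h)
  have hsub : Finset.univ.image u ⊆ q.derivative.roots.toFinset := by
    intro y hy
    obtain ⟨j, -, rfl⟩ := Finset.mem_image.1 hy
    exact Multiset.mem_toFinset.2 ((mem_roots hq0).2 (hu j))
  have hcard : q.derivative.roots.toFinset.card ≤ (Finset.univ.image u).card := by
    rw [Finset.card_image_of_injective _ huinj, Finset.card_univ, Fintype.card_fin]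
    calc _ ≤ _ := Multiset.toFinset_card_le _
      _ ≤ _ := card_roots' _
      _ ≤ _ := natDegree_derivative_le q
      _ = _ := by rw [hqn]
  have hxm : x ∈ Finset.univ.image u := by
    rw [Finset.eq_of_subset_of_card_le hsub hcard]
    exact Multiset.mem_toFinset.2 ((mem_roots hq0).2 hx)
  obtain ⟨j, -, rfl⟩ := Finset.mem_image.1 hxm
  exact ⟨j, rfl⟩

end CriticalPoints

/-! ### Extremal quantities -/

theorem critRadius_le {p : ℂ[X]} {w : ℂ} (hw : p.derivative.IsRoot w) (α : ℂ) :
    critRadius p α ≤ ‖α - w‖ :=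
  ciInf_le (f := fun w : {w : ℂ // p.derivative.IsRoot w} => ‖α - w‖)
    ⟨0, by rintro _ ⟨w, rfl⟩; exact norm_nonneg _⟩ ⟨w, hw⟩

theorem exists_critRadius_eq {p : ℂ[X]} {m : ℕ} (hm : m ≠ 0) {u : Fin m → ℂ}
    (hu : ∀ x, p.derivative.IsRoot x ↔ ∃ j, x = u j) (α : ℂ) :
    ∃ j, critRadius p α = ‖α - u j‖ := by
  have hne : Nonempty {w : ℂ // p.derivative.IsRoot w} :=
    ⟨⟨u ⟨0, Nat.pos_of_ne_zero hm⟩, (hu _).2 ⟨_, rfl⟩⟩⟩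
  have hfin : Finite {w : ℂ // p.derivative.IsRoot w} := by
    refine Set.Finite.subset (Set.finite_range u) ?_
    intro x hx
    obtain ⟨j, rfl⟩ := (hu x).1 hx
    exact ⟨j, rfl⟩
  obtain ⟨⟨x, hx⟩, h⟩ := exists_eq_ciInf_of_finite
    (f := fun w : {w : ℂ // p.derivative.IsRoot w} => ‖α - w‖)
  obtain ⟨j, rfl⟩ := (hu x).1 hx
  exact ⟨j, h.symm⟩

theorem critRadius_le_d {q : ℂ[X]} (hq : q ≠ 0) {x : ℂ} (hx : q.IsRoot x) :
    critRadius q x ≤ d q := by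
  have : Finite {x : ℂ // q.IsRoot x} := by
    refine Set.Finite.subset q.roots.toFinset.finite_toSet fun y hy => ?_
    have hy' : q.IsRoot y := hy
    simpa [hq] using hy'
  exact le_ciSup (f := fun x : {x : ℂ // q.IsRoot x} => critRadius q x)
    (Set.finite_range _).bddAbove ⟨x, hx⟩

theorem d_le {q : ℂ[X]} {r : ℝ} (hne : ∃ x, q.IsRoot x)
    (h : ∀ x, q.IsRoot x → critRadius q x ≤ r) : d q ≤ r := by
  obtain ⟨x, hx⟩ := hne
  have : Nonempty {x : ℂ // q.IsRoot x} := ⟨⟨x, hx⟩⟩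
  exact ciSup_le fun x => h x x.2

theorem prod_X_sub_C_mem_S {n : ℕ} {ζ : Fin n → ℂ} (h : ∀ i, ‖ζ i‖ ≤ 1) :
    ∏ i, (X - C (ζ i)) ∈ S n := by
  refine ⟨monic_prod_X_sub_C _ _, ?_, ?_⟩
  · rw [natDegree_finsetProd_X_sub_C_eq_card]; simp
  · intro x hx
    obtain ⟨i, rfl⟩ := isRoot_prod_X_sub_C_iff.1 hx
    exact h i

theorem exists_eq_prod_X_sub_C {n : ℕ} {q : ℂ[X]} (hq : q ∈ S n) :
    ∃ ζ : Fin n → ℂ, q = ∏ i, (X - C (ζ i)) := by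
  have hsp := IsAlgClosed.splits q
  have hcard : q.roots.toList.length = n := by
    rw [Multiset.length_toList, ← hsp.natDegree_eq_card_roots, hq.2.1]
  subst hcard
  refine ⟨fun i => q.roots.toList.get i, ?_⟩
  have h := prod_multiset_X_sub_C_of_monic_of_roots_card_eq hq.1
    hsp.natDegree_eq_card_roots.symm
  conv_lhs => rw [← h, ← Multiset.coe_toList q.roots, Multiset.map_coe, Multiset.prod_coe]
  rw [← List.prod_ofFn]
  congr 1
  conv_lhs => rw [← List.ofFn_get q.roots.toList, List.map_ofFn]
  rfl

/-- A polynomial of `S n` is obtained from `∏ (X - z i)` by a displacement of the zeros whose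
norm is the distance of the two polynomials. -/
theorem exists_displacement {n : ℕ} (z : Fin n → ℂ) {q : ℂ[X]} (hq : q ∈ S n) :
    ∃ v : Fin n → ℂ, q = ∏ i, (X - C (z i + v i)) ∧ ‖v‖ = Δ n q (∏ i, (X - C (z i))) := by
  obtain ⟨ζ, rfl⟩ := exists_eq_prod_X_sub_C hq
  obtain ⟨σ, hσ⟩ := (Δ_prod ζ z).1
  refine ⟨fun i => ζ (σ.symm i) - z i, ?_, ?_⟩
  · simp only [add_sub_cancel]
    exact (Equiv.prod_comp σ.symm fun i => X - C (ζ i)).symm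
  · rw [← hσ]
    refine le_antisymm ((pi_norm_le_iff_of_nonneg (norm_nonneg _)).2 fun i => ?_)
      ((pi_norm_le_iff_of_nonneg (norm_nonneg _)).2 fun i => ?_)
    · simpa using norm_le_pi_norm (fun i => ζ i - z (σ i)) (σ.symm i)
    · simpa using norm_le_pi_norm (fun i => ζ (σ.symm i) - z i) (σ i)

theorem Δ_displacement_le {n : ℕ} (z v : Fin n → ℂ) :
    Δ n (∏ i, (X - C (z i + v i))) (∏ i, (X - C (z i))) ≤ ‖v‖ := by
  have := (Δ_prod (fun i => z i + v i) z).2 ⟨1, rfl⟩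
  simpa using this

theorem Δ_prod_nonneg {n : ℕ} (z ζ : Fin n → ℂ) :
    0 ≤ Δ n (∏ i, (X - C (z i))) (∏ i, (X - C (ζ i))) := by
  obtain ⟨σ, hσ⟩ := (Δ_prod z ζ).1
  rw [← hσ]
  exact norm_nonneg _

/-! ### Second-order estimates of the modulus -/

theorem norm_one_add_le (x : ℂ) : ‖1 + x‖ ≤ 1 + x.re + ‖x‖ ^ 2 / 2 := by
  have h : ‖1 + x‖ ^ 2 = 1 + 2 * x.re + ‖x‖ ^ 2 := by
    rw [Complex.sq_norm, Complex.sq_norm, Complex.normSq_apply, Complex.normSq_apply]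
    simp
    ring
  nlinarith [sq_nonneg (‖1 + x‖ - 1)]

theorem one_add_re_le_norm (x : ℂ) : 1 + x.re ≤ ‖1 + x‖ := by
  simpa using Complex.re_le_norm (1 + x)

/-- A displacement that keeps a point of the unit circle in the closed disk has no outward
component. -/
theorem re_conj_mul_nonpos {a v : ℂ} (ha : ‖a‖ = 1) (hav : ‖a + v‖ ≤ 1) :
    ((starRingEnd ℂ) a * v).re ≤ 0 := by
  have h1 : ‖a‖ ^ 2 = 1 := by rw [ha]; norm_num
  have h2 : ‖a + v‖ ^ 2 ≤ 1 := by
    nlinarith [norm_nonneg (a + v)]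
  rw [Complex.sq_norm, Complex.normSq_apply] at h1 h2
  simp only [Complex.add_re, Complex.add_im] at h2
  simp only [Complex.mul_re, Complex.conj_re, Complex.conj_im]
  nlinarith [sq_nonneg v.re, sq_nonneg v.im]

/-- A displacement with an inward component keeps a point of the closed disk inside for small
positive times. -/
theorem eventually_norm_add_smul_le {a v : ℂ} (ha : ‖a‖ ≤ 1)
    (hv : ‖a‖ = 1 → ((starRingEnd ℂ) a * v).re < 0) :
    ∀ᶠ t : ℝ in 𝓝[>] 0, ‖a + t * v‖ ≤ 1 := by
  rcases ha.lt_or_eq with h | h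
  · have hc : ContinuousAt (fun t : ℝ => ‖a + t * v‖) 0 := by fun_prop
    exact ((hc.eventually_lt_const (by simpa using h)).filter_mono nhdsWithin_le_nhds).mono
      fun t ht => ht.le
  · have hneg := hv h
    have hc : ContinuousAt (fun t : ℝ => 2 * ((starRingEnd ℂ) a * v).re + t * ‖v‖ ^ 2) 0 := by
      fun_prop
    have hev := (hc.eventually_lt_const (u := 0) (by
      simp only [zero_mul, add_zero]; linarith)).filter_mono
      (nhdsWithin_le_nhds (s := Set.Ioi 0))
    filter_upwards [hev, self_mem_nhdsWithin] with t ht ht0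
    have ht0 : 0 < t := ht0
    have h1 : ‖a‖ ^ 2 = 1 := by rw [h]; norm_num
    have h2 : ‖a + t * v‖ ^ 2 =
        ‖a‖ ^ 2 + t * (2 * ((starRingEnd ℂ) a * v).re + t * ‖v‖ ^ 2) := by
      simp only [Complex.sq_norm, Complex.normSq_apply, Complex.add_re, Complex.add_im,
        Complex.mul_re, Complex.mul_im, Complex.conj_re, Complex.conj_im, Complex.ofReal_re,
        Complex.ofReal_im]
      ring
    have h3 : t * (2 * ((starRingEnd ℂ) a * v).re + t * ‖v‖ ^ 2) < 0 :=
      mul_neg_of_pos_of_neg ht0 ht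
    nlinarith [norm_nonneg (a + t * v)]

/-! ### The two implications -/

section Main

variable {n : ℕ} {z : Fin n → ℂ} {w : Fin (n - 1) → ℂ}

theorem critRadius_pos (hn : 2 ≤ n) (hz : Function.Injective z)
    (hw : derivative (∏ i, (X - C (z i))) = C (n : ℂ) * ∏ j, (X - C (w j))) (k : Fin n) :
    0 < critRadius (∏ i, (X - C (z i))) (z k) := by
  obtain ⟨j, hj⟩ := exists_critRadius_eq (by omega)
    (fun _ => isRoot_derivative_iff (by omega) hw) (z k)
  rw [hj, norm_sub_rev, norm_pos_iff]
  exact critical_sub_zero_ne_zero (by omega) hz hw j k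

/-- The rows of the second block have disjoint supports, so a nontrivial nonnegative relation
between the rows of `A(p; a)` involves a row of the first block. -/
theorem exists_inl_ne_zero {p : ℂ[X]} {k : Fin n}
    {μ : {j : Fin (n - 1) // ‖w j - z k‖ = critRadius p (z k)} ⊕ {s : Fin n // ‖z s‖ = 1} → ℝ}
    (hμ : ∃ r, μ r ≠ 0) (h : ∀ i, ∑ r, (μ r : ℂ) * A p z w k r i = 0) :
    ∃ j, μ (Sum.inl j) ≠ 0 := by
  by_contra! hall
  obtain ⟨r | s, hr⟩ := hμ
  · exact hr (hall r)
  · have h1 := h s.1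
    rw [Fintype.sum_sum_type, Finset.sum_eq_zero fun j _ => by rw [hall j]; simp, zero_add,
      Finset.sum_eq_single s] at h1
    · have hz0 : z s.1 ≠ 0 := by
        rw [← norm_pos_iff, s.2]; exact one_pos
      simp [A, hr, hz0] at h1
    · intro t _ hts
      have : s.1 ≠ t.1 := fun h => hts (Subtype.ext h.symm)
      simp [A, this]
    · simp

theorem sum_A_inr_mul {p : ℂ[X]} {k : Fin n} (s : {s : Fin n // ‖z s‖ = 1}) (v : Fin n → ℂ) :
    ∑ i, A p z w k (Sum.inr s) i * v i = -((starRingEnd ℂ) (z s) * v s) := by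
  rw [Finset.sum_eq_single s.1]
  · simp [A]
  · intro i _ hi
    simp [A, hi]
  · simp

theorem sum_A_inl_mul (hn : n ≠ 0) (hz : Function.Injective z)
    (hw : derivative (∏ i, (X - C (z i))) = C (n : ℂ) * ∏ j, (X - C (w j)))
    (hwi : Function.Injective w) (k : Fin n)
    (j : {j : Fin (n - 1) // ‖w j - z k‖ = critRadius (∏ i, (X - C (z i))) (z k)})
    (v : Fin n → ℂ) :
    ∑ i, A (∏ i, (X - C (z i))) z w k (Sum.inl j) i * v i =
      (critShift z (w j) v - v k) / (w j - z k) :=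
  sum_coeffα_mul hn hz hw hwi k j v

/-- A nonnegative relation between the rows forces, for every displacement that stays in the
closed disk, some critical point on the extremal circle not to recede to first order. -/
theorem PositivelySingular.exists_re_nonpos (hn : n ≠ 0) (hz : Function.Injective z)
    (hw : derivative (∏ i, (X - C (z i))) = C (n : ℂ) * ∏ j, (X - C (w j)))
    (hwi : Function.Injective w) {k : Fin n}
    (hA : PositivelySingular (A (∏ i, (X - C (z i))) z w k)) {v : Fin n → ℂ}
    (hv : ∀ i, ‖z i + v i‖ ≤ 1) :
    ∃ j, ‖w j - z k‖ = critRadius (∏ i, (X - C (z i))) (z k) ∧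
      ((critShift z (w j) v - v k) / (w j - z k)).re ≤ 0 := by
  obtain ⟨μ, hμ0, hμne, hμ⟩ := hA
  obtain ⟨j0, hj0⟩ := exists_inl_ne_zero hμne hμ
  by_contra! hcon
  have hsum : ∑ r, (μ r : ℂ) * ∑ i, A (∏ i, (X - C (z i))) z w k r i * v i = 0 := by
    simp only [Finset.mul_sum]
    rw [Finset.sum_comm]
    refine Finset.sum_eq_zero fun i _ => ?_
    simp only [← mul_assoc, ← Finset.sum_mul, hμ i, zero_mul]
  have hre := congrArg Complex.re hsum
  rw [Complex.re_sum, Fintype.sum_sum_type, Complex.zero_re] at hre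
  simp only [Complex.re_ofReal_mul, sum_A_inl_mul hn hz hw hwi, sum_A_inr_mul] at hre
  have h1 : 0 < ∑ j : {j : Fin (n - 1) // ‖w j - z k‖ = critRadius (∏ i, (X - C (z i))) (z k)},
      μ (Sum.inl j) * ((critShift z (w j) v - v k) / (w j - z k)).re :=
    Finset.sum_pos' (fun j _ => mul_nonneg (hμ0 _) (hcon j j.2).le)
      ⟨j0, Finset.mem_univ _, mul_pos ((hμ0 _).lt_of_ne' hj0) (hcon j0 j0.2)⟩
  have h2 : 0 ≤ ∑ s : {s : Fin n // ‖z s‖ = 1},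
      μ (Sum.inr s) * (-((starRingEnd ℂ) (z s) * v s)).re := by
    refine Finset.sum_nonneg fun s _ => mul_nonneg (hμ0 _) ?_
    rw [Complex.neg_re, neg_nonneg]
    exact re_conj_mul_nonpos s.2 (hv s)
  linarith

/-- A bound for the critical shifts that is uniform over the critical points. -/
theorem exists_norm_critShift_le_all {ι κ : Type*} [Fintype ι] [Fintype κ] (z : ι → ℂ)
    (w : κ → ℂ) : ∃ B, 0 ≤ B ∧ ∀ j v, ‖critShift z (w j) v‖ ≤ B * ‖v‖ := by
  choose B hB0 hB using fun j => exists_norm_critShift_le z (w j)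
  refine ⟨∑ j, B j, Finset.sum_nonneg fun j _ => hB0 j, fun j v => (hB j v).trans ?_⟩
  gcongr
  exact Finset.single_le_sum (fun j _ => hB0 j) (Finset.mem_univ j)

/-- Distances from a displaced zero to a displaced critical point, in terms of the relative
displacement. -/
theorem norm_displaced_sub {a b : ℂ} (h : b - a ≠ 0) (v u : ℂ) :
    ‖a + v - u‖ = ‖b - a‖ * ‖1 + (u - b - v) / (b - a)‖ := by
  rw [← norm_mul, norm_sub_rev]
  congr 1
  field_simp
  ring

/-- Some critical point on the extremal circle does not recede to first order, so the exponent
`1 + κ = 2` works; the zeros other than `z k` stay strictly nearer to a critical point. -/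
theorem linearlyInextensible_of_positivelySingular (hn : 2 ≤ n) {k : Fin n}
    (hS : ∏ i, (X - C (z i)) ∈ S n) (hz : Function.Injective z)
    (hw : derivative (∏ i, (X - C (z i))) = C (n : ℂ) * ∏ j, (X - C (w j)))
    (hwi : Function.Injective w)
    (ha : critRadius (∏ i, (X - C (z i))) (z k) = d (∏ i, (X - C (z i))))
    (hlt : ∀ i, i ≠ k → critRadius (∏ i, (X - C (z i))) (z i) < d (∏ i, (X - C (z i))))
    (hA : PositivelySingular (A (∏ i, (X - C (z i))) z w k)) :
    LinearlyInextensible n (∏ i, (X - C (z i))) := by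
  have hn0 : n ≠ 0 := by omega
  obtain ⟨K, hK0, hK⟩ := eventually_critical_points hn0 hz hw hwi
  obtain ⟨B, hB0, hB⟩ := exists_norm_critShift_le_all z w
  have hR := critRadius_pos hn hz hw k
  rw [ha] at hR
  set R := d (∏ i, (X - C (z i))) with hRdef
  -- For each other zero, a nearest critical point remains closer than `R`.
  choose near hnear using fun i => exists_critRadius_eq (p := ∏ i, (X - C (z i)))
    (by omega) (fun _ => isRoot_derivative_iff hn0 hw) (z i)
  have hother : ∀ᶠ v in 𝓝 (0 : Fin n → ℂ), ∀ i, i ≠ k →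
      ‖z i - w (near i)‖ + ‖v‖ + B * ‖v‖ + K * ‖v‖ ^ 2 < R := by
    rw [eventually_all]; intro i
    by_cases hi : i = k
    · simp [hi]
    have hc : Continuous fun v : Fin n → ℂ =>
        ‖z i - w (near i)‖ + ‖v‖ + B * ‖v‖ + K * ‖v‖ ^ 2 := by fun_prop
    refine (hc.continuousAt.eventually_lt_const ?_).mono fun v hv _ => hv
    have := hlt i hi
    rw [hnear i] at this
    simpa using this
  have hsmall : ∀ᶠ v in 𝓝 (0 : Fin n → ℂ), ‖v‖ < 1 :=
    continuous_norm.continuousAt.eventually_lt_const (by simp)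
  obtain ⟨ε, hε, hball⟩ := Metric.eventually_nhds_iff.1 ((hK.and hother).and hsmall)
  refine ⟨hS, ε, hε, K + (B + 1 + K) ^ 2 / (2 * R), by positivity, 1, one_pos, ?_⟩
  intro q hq hΔ
  obtain ⟨v, rfl, hv⟩ := exists_displacement z hq
  rw [← hv] at hΔ ⊢
  obtain ⟨⟨⟨u, hu, huroot⟩, hoth⟩, hv1⟩ := hball (by simpa using hΔ)
  have hrpow : ‖v‖ ^ ((1 : ℝ) + 1) = ‖v‖ ^ 2 := by
    rw [one_add_one_eq_two, Real.rpow_two]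
  rw [hrpow]
  have hvz : ∀ i, ‖z i + v i‖ ≤ 1 := fun i => hq.2.2 _ (isRoot_prod_X_sub_C_iff.2 ⟨i, rfl⟩)
  refine d_le ⟨_, isRoot_prod_X_sub_C_iff.2 ⟨k, rfl⟩⟩ fun x hx => ?_
  obtain ⟨i, rfl⟩ := isRoot_prod_X_sub_C_iff.1 hx
  by_cases hi : i = k
  · subst hi
    obtain ⟨j, hj, hre⟩ := hA.exists_re_nonpos hn0 hz hw hwi hvz
    rw [ha] at hj
    refine (critRadius_le ((huroot _).2 ⟨j, rfl⟩) _).trans ?_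
    have hne := critical_sub_zero_ne_zero hn0 hz hw j i
    rw [norm_displaced_sub hne, hj]
    refine (mul_le_mul_of_nonneg_left (norm_one_add_le _) hR.le).trans ?_
    set ρ := (u j - w j - v i) / (w j - z i) with hρ
    have hsplit : ρ = (critShift z (w j) v - v i) / (w j - z i) +
        (u j - (w j + critShift z (w j) v)) / (w j - z i) := by
      rw [hρ, ← add_div]; ring
    have hρre : ρ.re ≤ K * ‖v‖ ^ 2 / R := by
      rw [hsplit, Complex.add_re]
      have h1 : ((u j - (w j + critShift z (w j) v)) / (w j - z i)).re ≤ K * ‖v‖ ^ 2 / R := by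
        refine (Complex.re_le_norm _).trans ?_
        rw [norm_div, hj]
        gcongr
        exact hu j
      linarith
    have hρn : ‖ρ‖ ≤ (B + 1 + K) * ‖v‖ / R := by
      rw [hρ, norm_div, hj]
      gcongr
      have h2 : u j - w j - v i = critShift z (w j) v +
          (u j - (w j + critShift z (w j) v)) - v i := by ring
      rw [h2]
      refine (norm_sub_le _ _).trans ((add_le_add_left (norm_add_le _ _) _).trans ?_)
      have h3 : K * ‖v‖ ^ 2 ≤ K * ‖v‖ := by
        gcongr
        nlinarith [norm_nonneg v]
      linarith [hB j v, hu j, norm_le_pi_norm v i]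
    calc R * (1 + ρ.re + ‖ρ‖ ^ 2 / 2)
        ≤ R * (1 + K * ‖v‖ ^ 2 / R + ((B + 1 + K) * ‖v‖ / R) ^ 2 / 2) := by gcongr
      _ = _ := by rw [← hRdef]; field_simp; ring
  · refine (critRadius_le ((huroot _).2 ⟨near i, rfl⟩) _).trans ?_
    have h1 : z i + v i - u (near i) = (z i - w (near i)) + v i -
        critShift z (w (near i)) v - (u (near i) - (w (near i) + critShift z (w (near i)) v)) := by
      ring
    have h2 : ‖z i + v i - u (near i)‖ ≤ ‖z i - w (near i)‖ + ‖v i‖ +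
        ‖critShift z (w (near i)) v‖ +
        ‖u (near i) - (w (near i) + critShift z (w (near i)) v)‖ := by
      rw [h1]
      exact (norm_sub_le _ _).trans (add_le_add_left ((norm_sub_le _ _).trans
        (add_le_add_left (norm_add_le _ _) _)) _)
    have h3 : 0 ≤ (K + (B + 1 + K) ^ 2 / (2 * R)) * ‖v‖ ^ 2 := by positivity
    linarith [hoth i hi, norm_le_pi_norm v i, hB (near i) v, hu (near i)]

/-- Otherwise some direction moves all zeros of modulus one inwards and all critical points of the
extremal circle away from `z k` at positive speed, so `d` grows linearly along it. -/
theorem positivelySingular_of_linearlyInextensible (hn : 2 ≤ n) {k : Fin n}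
    (hz : Function.Injective z)
    (hw : derivative (∏ i, (X - C (z i))) = C (n : ℂ) * ∏ j, (X - C (w j)))
    (hwi : Function.Injective w)
    (ha : critRadius (∏ i, (X - C (z i))) (z k) = d (∏ i, (X - C (z i))))
    (hL : LinearlyInextensible n (∏ i, (X - C (z i)))) :
    PositivelySingular (A (∏ i, (X - C (z i))) z w k) := by
  have hn0 : n ≠ 0 := by omega
  by_contra hA
  obtain ⟨v, hv⟩ := exists_re_pos_of_not_positivelySingular hA
  obtain ⟨hS, ε, hε, K', hK'0, κ, hκ, hext⟩ := hL
  obtain ⟨K, hK0, hK⟩ := eventually_critical_points hn0 hz hw hwi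
  obtain ⟨B, hB0, hB⟩ := exists_norm_critShift_le_all z w
  have hR := critRadius_pos hn hz hw k
  obtain ⟨c, hc, hcr⟩ : ∃ c : ℝ, 0 < c ∧
      ∀ r, c ≤ (∑ i, A (∏ i, (X - C (z i))) z w k r i * v i).re := by
    obtain ⟨c, hc, h⟩ := Pi.exists_forall_pos_add_lt hv
    exact ⟨c, hc, fun r => by simpa using (h r).le⟩
  have htend : Tendsto (fun t : ℝ => t • v) (𝓝[>] 0) (𝓝 0) := by
    have : Continuous fun t : ℝ => t • v := by fun_prop
    simpa using (this.tendsto 0).mono_left nhdsWithin_le_nhds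
  set R := critRadius (∏ i, (X - C (z i))) (z k) with hRdef
  have hdisk : ∀ᶠ t : ℝ in 𝓝[>] 0, ∀ i, ‖z i + t * v i‖ ≤ 1 := by
    rw [eventually_all]
    intro i
    refine eventually_norm_add_smul_le
      (hS.2.2 _ (isRoot_prod_X_sub_C_iff.2 ⟨i, rfl⟩)) fun hi => ?_
    have := hv (Sum.inr ⟨i, hi⟩)
    rw [sum_A_inr_mul, Complex.neg_re] at this
    linarith
  have hclose : ∀ᶠ t : ℝ in 𝓝[>] 0, t * ‖v‖ < ε := by
    have hcont : Continuous fun t : ℝ => t * ‖v‖ := by fun_prop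
    exact (hcont.continuousAt.eventually_lt_const (by simpa using hε)).filter_mono
      nhdsWithin_le_nhds
  -- The critical points off the extremal circle stay outside a slightly larger one.
  have hinact : ∀ᶠ t : ℝ in 𝓝[>] 0, ∀ j, ‖w j - z k‖ ≠ R →
      R + R * (t * c) + t * ‖v‖ + B * (t * ‖v‖) < ‖w j - z k‖ := by
    rw [eventually_all]; intro j
    by_cases hj : ‖w j - z k‖ = R
    · simp [hj]
    have hcont : Continuous fun t : ℝ => R + R * (t * c) + t * ‖v‖ + B * (t * ‖v‖) := by
      fun_prop
    refine ((hcont.continuousAt.eventually_lt_const ?_).filter_mono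
      nhdsWithin_le_nhds).mono fun t ht _ => ht
    have : R ≤ ‖w j - z k‖ := by
      rw [norm_sub_rev]
      exact critRadius_le ((isRoot_derivative_iff hn0 hw).2 ⟨j, rfl⟩) _
    simpa using this.lt_of_ne' hj
  -- Comparing both bounds for `d` and dividing by `t` leaves a positive constant below a null
  -- function.
  have hmain : ∀ᶠ t : ℝ in 𝓝[>] 0,
      R * c ≤ K * (t * ‖v‖ ^ 2) + K' * (t ^ κ * ‖v‖ ^ (1 + κ)) := by
    filter_upwards [htend.eventually hK, hdisk, hclose, hinact, self_mem_nhdsWithin]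
      with t ⟨u, hu, huroot⟩ hdt hct hit ht0
    have ht0 : 0 < t := ht0
    have hnorm : ‖t • v‖ = t * ‖v‖ := by rw [norm_smul, Real.norm_of_nonneg ht0.le]
    set q := ∏ i, (X - C (z i + (t • v) i)) with hq
    have hqS : q ∈ S n := prod_X_sub_C_mem_S fun i => by simpa using hdt i
    have hΔ : Δ n q (∏ i, (X - C (z i))) ≤ t * ‖v‖ := hnorm ▸ Δ_displacement_le z (t • v)
    have hqd := hext q hqS (hΔ.trans_lt hct)
    have hlow : R + R * (t * c) - K * (t * ‖v‖) ^ 2 ≤ critRadius q (z k + (t • v) k) := by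
      obtain ⟨j, hj⟩ := exists_critRadius_eq (by omega) huroot (z k + (t • v) k)
      rw [hj]
      have huj := hu j
      rw [hnorm] at huj
      by_cases hact : ‖w j - z k‖ = R
      · have hne := critical_sub_zero_ne_zero hn0 hz hw j k
        rw [norm_displaced_sub hne, hact]
        refine le_trans ?_ (mul_le_mul_of_nonneg_left (one_add_re_le_norm _) hR.le)
        have hsplit : (u j - w j - (t • v) k) / (w j - z k) =
            t * ((critShift z (w j) v - v k) / (w j - z k)) +
            (u j - (w j + critShift z (w j) (t • v))) / (w j - z k) := by
          rw [critShift_smul, Pi.smul_apply, Complex.real_smul]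
          ring
        have h1 := hcr (Sum.inl ⟨j, hact⟩)
        rw [sum_A_inl_mul hn0 hz hw hwi] at h1
        have h2 : -(K * (t * ‖v‖) ^ 2 / R) ≤
            ((u j - (w j + critShift z (w j) (t • v))) / (w j - z k)).re := by
          have h3 := (abs_le.1 (Complex.abs_re_le_norm
            ((u j - (w j + critShift z (w j) (t • v))) / (w j - z k)))).1
          refine le_trans (neg_le_neg ?_) h3
          rw [norm_div, hact]
          gcongr
        rw [hsplit, Complex.add_re, Complex.re_ofReal_mul]
        calc R + R * (t * c) - K * (t * ‖v‖) ^ 2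
            = R * (1 + (t * c + -(K * (t * ‖v‖) ^ 2 / R))) := by field_simp; ring
          _ ≤ _ := by gcongr
      · have h1 := hit j hact
        have h2 := hB j (t • v)
        have h3 := norm_le_pi_norm (t • v) k
        rw [hnorm] at h2 h3
        have h4 : w j - z k = (t • v) k - critShift z (w j) (t • v) -
            (u j - (w j + critShift z (w j) (t • v))) - (z k + (t • v) k - u j) := by ring
        have h5 : ‖w j - z k‖ ≤ ‖(t • v) k‖ + ‖critShift z (w j) (t • v)‖ +
            ‖u j - (w j + critShift z (w j) (t • v))‖ + ‖z k + (t • v) k - u j‖ := by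
          rw [h4]
          exact (norm_sub_le _ _).trans (add_le_add_left ((norm_sub_le _ _).trans
            (add_le_add_left (norm_sub_le _ _) _)) _)
        linarith
    have hup := critRadius_le_d hqS.1.ne_zero
      (isRoot_prod_X_sub_C_iff.2 ⟨k, rfl⟩ : q.IsRoot (z k + (t • v) k))
    have hpow : Δ n q (∏ i, (X - C (z i))) ^ (1 + κ) ≤ (t * ‖v‖) ^ (1 + κ) :=
      Real.rpow_le_rpow (Δ_prod_nonneg _ _) hΔ (by linarith)
    have hsplit : (t * ‖v‖) ^ (1 + κ) = t * (t ^ κ * ‖v‖ ^ (1 + κ)) := by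
      rw [Real.mul_rpow ht0.le (norm_nonneg v), Real.rpow_add ht0, Real.rpow_one, mul_assoc]
    have hK'pow := mul_le_mul_of_nonneg_left hpow hK'0
    rw [hsplit] at hK'pow
    rw [← ha] at hqd
    refine le_of_mul_le_mul_left ?_ ht0
    linarith
  have hlim : Tendsto (fun t : ℝ => K * (t * ‖v‖ ^ 2) + K' * (t ^ κ * ‖v‖ ^ (1 + κ)))
      (𝓝[>] 0) (𝓝 0) := by
    have hcont : ContinuousAt
        (fun t : ℝ => K * (t * ‖v‖ ^ 2) + K' * (t ^ κ * ‖v‖ ^ (1 + κ))) 0 := by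
      have := Real.continuousAt_rpow_const 0 κ (Or.inr hκ.le)
      fun_prop
    have h := hcont.tendsto.mono_left (nhdsWithin_le_nhds (s := Set.Ioi 0))
    simpa [Real.zero_rpow hκ.ne'] using h
  exact absurd (ge_of_tendsto hlim hmain) (not_le.2 (mul_pos hR hc))

end Main

end Sendov

theorem theorem3p5 (n : ℕ) (hn : 3 ≤ n) (p : ℂ[X]) (hpS : p ∈ Sendov.S n)
    (z : Fin n → ℂ) (hz : p = ∏ i, (X - C (z i)))
    (w : Fin (n - 1) → ℂ) (hw : derivative p = C (n : ℂ) * ∏ j, (X - C (w j)))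
    (hz_simple : Function.Injective z) (hw_simple : Function.Injective w)
    (ha : Sendov.critRadius p (z ⟨0, Nat.zero_lt_of_lt hn⟩) = Sendov.d p)
    (hlt : ∀ i : Fin n, i ≠ ⟨0, Nat.zero_lt_of_lt hn⟩ → Sendov.critRadius p (z i) < Sendov.d p) :
    Sendov.LinearlyInextensible n p ↔
      Sendov.PositivelySingular (Sendov.A p z w ⟨0, Nat.zero_lt_of_lt hn⟩) := by
  subst hz
  exact ⟨Sendov.positivelySingular_of_linearlyInextensible (by omega) hz_simple hw hw_simple ha,
    Sendov.linearlyInextensible_of_positivelySingular (by omega) hpS hz_simple hw hw_simple ha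
      hlt⟩
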